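/- Let $n\ge 2$ be an integer. Call a real $n\times n$ matrix a standardized Laplacian matrix of order $n$ if all its row sums are equal to $0$ and its off-diagonal entries are nonpositive and do not exceed $1/n$ in absolute value. Then all (complex) eigenvalues of standardized Laplacian matrices of order $n$ belong to the intersection of the following regions of the complex plane: (i) two closed disks, one centered at $1/n$, the other centered at $1-1/n$, each having radius $1-1/n$; (ii) two closed smaller (that is, convex) angles, one bounded by the two half-lines drawn from $1$ through $e^{-2\pi\mathrm{i}/n}$ and $e^{2\pi\mathrm{i}/n}$, the other bounded by the two half-lines drawn from $0$ through $e^{-(\pi/2-\pi/n)\mathrm{i}}$ and $e^{(\pi/2-\pi/n)\mathrm{i}}$ (for $n=2$ the two sides of each angle coincide, and the angle is that half-line); (iii) the band $|\mathrm{Im}(z)|\le\frac{1}{2n}\cot\frac{\pi}{2n}$. -/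

import Mathlib

/-- A real square matrix of order `n` is a standardized Laplacian matrix if its row sums are `0`
and its off-diagonal entries are nonpositive and at most `1 / n` in absolute value. -/
structure IsStandardizedLaplacian {n : ℕ} (L : Matrix (Fin n) (Fin n) ℝ) : Prop where
  row_sum_eq_zero : ∀ i, ∑ j, L i j = 0
  off_diag_nonpos : ∀ i j, i ≠ j → L i j ≤ 0
  abs_off_diag_le : ∀ i j, i ≠ j → |L i j| ≤ 1 / (n : ℝ)

/-- The closed smaller (i.e. convex) angle in the complex plane bounded by the half-lines drawn
from `v` through `p` and from `v` through `q`, where `p` and `q` are different from `v` and do not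
lie in opposite directions from `v`. It degenerates to a half-line when the two sides coincide. -/
def closedSmallerAngle (v p q : ℂ) : Set ℂ :=
  {z | ∃ s t : ℝ, 0 ≤ s ∧ 0 ≤ t ∧ z = v + (s : ℂ) * (p - v) + (t : ℂ) * (q - v)}

/-!
Write `z` for an eigenvalue of a standardized Laplacian matrix `L` of order `n`.

* Symmetry. The complement `1 - J / n - L` (`J` the all-ones matrix) is again a standardized
  Laplacian matrix, and for `z ≠ 0, 1` it has the eigenvalue `1 - z`
  (`hasEigenvalue_complementLaplacian`). So the disk about `1 / n` and the angle at `1` follow from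
  the disk about `1 - 1 / n` and the angle at `0`.
* Disk. The Gershgorin disks of `L` have centre and radius `L k k ≤ 1 - 1 / n`.
* Angle. Let `L v = z v` with `z` in the open first quadrant and `α = π / 2 - arg z`. From each `i`
  with `v i ≠ 0` there is a `j` whose ratio `v j / v i` differs from `1` and lies in a half-plane
  with `1` on its boundary at distance `cos α` from `0` (`exists_ratio_mem_halfPlane`). Following
  such steps closes up a cycle of length `m ≤ n`, around which the ratios have product `1`. By
  concavity of `log ∘ cos` this forces `m α ≥ π` (`pi_le_mul_of_prod_eq_one`), so
  `arg z ≤ π / 2 - π / n`.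
* Band. The imaginary part of `v* L v` involves only the differences `L i j - L j i`, at most
  `1 / n` in absolute value, and the cross products of the numbers `v i`. These satisfy the
  isoperimetric inequality `sum_abs_conj_mul_im_le`: after sorting by argument, centred partial sums
  form an antiperiodic sequence, for which there is a discrete Wirtinger inequality
  (`sum_mul_succ_le_of_antiperiodic`).
-/

/-! ### The antiperiodic discrete Wirtinger inequality -/

/-- Picone's identity against the ground state `s_j = sin (j π / n)`: for `0 < j < n - 1` the right
side minus the left is the square `s_j s_{j+1} (w_j / s_j - w_{j+1} / s_{j+1})²`, and for `j = 0`
and `j = n - 1` it is `0`. The last bracket telescopes in `j`. In `cot 0` and `cot π` division by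
`0` gives the junk value `0`, which is harmless because `w` vanishes at both ends. -/
theorem two_mul_mul_succ_le_of_dirichlet {n : ℕ} (hn : 2 ≤ n) (w : ℕ → ℝ) (h0 : w 0 = 0)
    (hwn : w n = 0) {j : ℕ} (hj : j < n) :
    2 * (w j * w (j + 1)) ≤ Real.cos (Real.pi / n) * (w j ^ 2 + w (j + 1) ^ 2)
      + Real.sin (Real.pi / n) * (w j ^ 2 * Real.cot (j * (Real.pi / n))
        - w (j + 1) ^ 2 * Real.cot ((j + 1 : ℕ) * (Real.pi / n))) := by
  have hn0 : (0 : ℝ) < n := by positivity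
  set θ := Real.pi / n with hθ
  have hθpos : 0 < θ := by positivity
  have hnθ : n * θ = Real.pi := by rw [hθ]; field_simp
  have hpos : ∀ k : ℕ, 0 < k → k < n → 0 < Real.sin (k * θ) := fun k hk hkn => by
    apply Real.sin_pos_of_pos_of_lt_pi
    · have : (0 : ℝ) < k := by exact_mod_cast hk
      positivity
    · rw [← hnθ]
      have : (k : ℝ) < n := by exact_mod_cast hkn
      gcongr
  have hs1 : 0 < Real.sin θ := by simpa using hpos 1 (by omega) (by omega)
  rcases Nat.eq_zero_or_pos j with rfl | hj0
  · simp only [h0, Real.cot_eq_cos_div_sin, zero_add, Nat.cast_one, one_mul]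
    field_simp
    ring_nf
    exact le_rfl
  rcases Nat.lt_or_ge (j + 1) n with hjn | hjn
  · have hs := hpos j hj0 hj
    have ht := hpos (j + 1) (by omega) hjn
    have e : ((j + 1 : ℕ) : ℝ) * θ = j * θ + θ := by push_cast; ring
    rw [e] at ht ⊢
    have e1 : Real.cos θ + Real.sin θ * Real.cot (j * θ)
        = Real.sin (j * θ + θ) / Real.sin (j * θ) := by
      rw [Real.cot_eq_cos_div_sin, Real.sin_add]; field_simp
    have e2 : Real.cos θ - Real.sin θ * Real.cot (j * θ + θ)
        = Real.sin (j * θ) / Real.sin (j * θ + θ) := by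
      have : Real.sin (j * θ) = Real.sin (j * θ + θ - θ) := by ring_nf
      rw [Real.cot_eq_cos_div_sin, this, Real.sin_sub (j * θ + θ), eq_div_iff ht.ne', sub_mul,
        mul_assoc _ (_ / _), div_mul_cancel₀ _ ht.ne']
      ring
    have key : 0 ≤ Real.sin (j * θ) * Real.sin (j * θ + θ)
        * (w j / Real.sin (j * θ) - w (j + 1) / Real.sin (j * θ + θ)) ^ 2 := by positivity
    have e3 : Real.sin (j * θ) * Real.sin (j * θ + θ)
        * (w j / Real.sin (j * θ) - w (j + 1) / Real.sin (j * θ + θ)) ^ 2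
        = w j ^ 2 * (Real.sin (j * θ + θ) / Real.sin (j * θ))
          + w (j + 1) ^ 2 * (Real.sin (j * θ) / Real.sin (j * θ + θ))
          - 2 * (w j * w (j + 1)) := by
      generalize Real.sin (j * θ + θ) = t at ht ⊢
      field_simp
      ring
    rw [e3, ← e1, ← e2] at key
    linarith
  · obtain rfl : n = j + 1 := by omega
    have e : (j : ℝ) * θ = Real.pi - θ := by rw [← hnθ]; push_cast; ring
    simp only [hwn, Real.cot_eq_cos_div_sin, e, Real.cos_pi_sub, Real.sin_pi_sub]
    field_simp
    ring_nf
    exact le_rfl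

theorem sum_mul_succ_le_of_dirichlet {n : ℕ} (hn : 2 ≤ n) (w : ℕ → ℝ) (h0 : w 0 = 0)
    (hwn : w n = 0) :
    ∑ j ∈ Finset.range n, w j * w (j + 1)
      ≤ Real.cos (Real.pi / n) * ∑ j ∈ Finset.range n, w j ^ 2 := by
  have h := Finset.sum_le_sum fun j hj =>
    two_mul_mul_succ_le_of_dirichlet hn w h0 hwn (Finset.mem_range.1 hj)
  have t1 := Finset.sum_range_sub' (fun j : ℕ => w j ^ 2 * Real.cot (j * (Real.pi / n))) n
  have t2 := Finset.sum_range_sub (fun j : ℕ => w j ^ 2) n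
  simp only [h0, hwn, Finset.sum_sub_distrib] at t1 t2
  simp only [Finset.sum_add_distrib, ← Finset.mul_sum, Finset.sum_sub_distrib] at h
  rw [t1] at h
  have t2' : ∑ j ∈ Finset.range n, w (j + 1) ^ 2 = ∑ j ∈ Finset.range n, w j ^ 2 := by
    linarith
  rw [t2'] at h
  linarith

/-- The discrete Wirtinger inequality for antiperiodic sequences: the largest eigenvalue of the
symmetric part of the antiperiodic shift is `cos (π / n)`. -/
theorem sum_mul_succ_le_of_antiperiodic {n : ℕ} (hn : 2 ≤ n) (a : ℕ → ℝ) (ha : a n = -a 0) :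
    ∑ j ∈ Finset.range n, a j * a (j + 1)
      ≤ Real.cos (Real.pi / n) * ∑ j ∈ Finset.range n, a j ^ 2 := by
  have hn0 : (n : ℝ) ≠ 0 := by positivity
  set θ := Real.pi / n with hθ
  have hnθ : n * θ = Real.pi := by rw [hθ]; field_simp
  -- `cos (j θ)` is antiperiodic and gives equality; subtracting its multiple with the same value
  -- at `0` leaves Dirichlet boundary values, and the cross terms telescope.
  set w : ℕ → ℝ := fun j => a j - a 0 * Real.cos (j * θ) with hw
  have hw0 : w 0 = 0 := by simp [hw]
  have hwn : w n = 0 := by simp [hw, hnθ, ha]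
  have h := sum_mul_succ_le_of_dirichlet hn w hw0 hwn
  rw [← hθ, Finset.mul_sum] at h
  rw [Finset.mul_sum]
  set F : ℕ → ℝ := fun j => a 0 * (Real.cos (j * θ - θ) * w j)
    + a 0 ^ 2 / 2 * (Real.cos (j * θ) * Real.cos (j * θ - θ)) with hF
  have hterm : ∀ j, a j * a (j + 1) - Real.cos θ * a j ^ 2
      = (w j * w (j + 1) - Real.cos θ * w j ^ 2) + (F (j + 1) - F j) := fun j => by
    have e : ((j + 1 : ℕ) : ℝ) * θ = j * θ + θ := by push_cast; ring
    have ea : ∀ k, a k = w k + a 0 * Real.cos (k * θ) := fun k => by simp [hw]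
    rw [ea j, ea (j + 1)]
    simp only [hF, e, add_sub_cancel_right]
    rw [Real.cos_add, Real.cos_sub]
    ring
  have hs := Finset.sum_congr (rfl : Finset.range n = Finset.range n) fun j _ => hterm j
  rw [Finset.sum_add_distrib, Finset.sum_range_sub, Finset.sum_sub_distrib,
    Finset.sum_sub_distrib] at hs
  have hF0 : F n - F 0 = 0 := by
    simp [hF, hw0, hwn, hnθ, Real.cos_pi_sub]
  linarith

/-! ### The sum of cross products of ordered plane vectors -/

theorem sum_add_succ_sq_le {n : ℕ} (hn : 2 ≤ n) (a : ℕ → ℝ) (ha : a n = -a 0) :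
    Real.sin (Real.pi / (2 * n)) ^ 2 * ∑ j ∈ Finset.range n, (a j + a (j + 1)) ^ 2
      ≤ Real.cos (Real.pi / (2 * n)) ^ 2 * ∑ j ∈ Finset.range n, (a (j + 1) - a j) ^ 2 := by
  have h := sum_mul_succ_le_of_antiperiodic hn a ha
  have t := Finset.sum_range_sub (fun j : ℕ => a j ^ 2) n
  rw [Finset.sum_sub_distrib, ha] at t
  have e1 : ∑ j ∈ Finset.range n, (a j + a (j + 1)) ^ 2
      = 2 * ∑ j ∈ Finset.range n, a j ^ 2 + 2 * ∑ j ∈ Finset.range n, a j * a (j + 1) := by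
    rw [Finset.sum_congr rfl fun j _ => show (a j + a (j + 1)) ^ 2
      = a j ^ 2 + a (j + 1) ^ 2 + 2 * (a j * a (j + 1)) by ring]
    rw [Finset.sum_add_distrib, Finset.sum_add_distrib, ← Finset.mul_sum]
    linarith
  have e2 : ∑ j ∈ Finset.range n, (a (j + 1) - a j) ^ 2
      = 2 * ∑ j ∈ Finset.range n, a j ^ 2 - 2 * ∑ j ∈ Finset.range n, a j * a (j + 1) := by
    rw [Finset.sum_congr rfl fun j _ => show (a (j + 1) - a j) ^ 2
      = a j ^ 2 + a (j + 1) ^ 2 - 2 * (a j * a (j + 1)) by ring]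
    rw [Finset.sum_sub_distrib, Finset.sum_add_distrib, ← Finset.mul_sum]
    linarith
  have hc : Real.cos (Real.pi / n) = 2 * Real.cos (Real.pi / (2 * n)) ^ 2 - 1 := by
    rw [← Real.cos_two_mul]; congr 1; field_simp
  have hsc := Real.sin_sq_add_cos_sq (Real.pi / (2 * n))
  rw [e1, e2]
  rw [hc] at h
  rw [← eq_sub_iff_add_eq] at hsc
  rw [hsc]
  linarith

/-- Twice the area spanned by a polygonal path with edges `(p j, q j)` and its chord is at most
`cot (π / (2 n)) / 2` times the sum of the squared edge lengths; the extremal path is half of a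
regular `2 n`-gon. -/
theorem sum_cross_le {n : ℕ} (hn : 2 ≤ n) (p q : ℕ → ℝ) :
    ∑ j ∈ Finset.range n, ∑ i ∈ Finset.range j, (p i * q j - q i * p j)
      ≤ 1 / 2 * Real.cot (Real.pi / (2 * n)) * ∑ j ∈ Finset.range n, (p j ^ 2 + q j ^ 2) := by
  have hn2 : (2 : ℝ) ≤ n := by exact_mod_cast hn
  have hs : 0 < Real.sin (Real.pi / (2 * n)) := by
    apply Real.sin_pos_of_pos_of_lt_pi (by positivity)
    rw [div_lt_iff₀ (by positivity)]
    nlinarith [Real.pi_pos]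
  have hc : 0 < Real.cos (Real.pi / (2 * n)) := by
    apply Real.cos_pos_of_mem_Ioo
    constructor
    · have : 0 < Real.pi / (2 * n) := by positivity
      linarith [Real.pi_pos]
    · rw [div_lt_div_iff₀ (by positivity) (by positivity)]
      nlinarith [Real.pi_pos]
  -- Shifting the partial sums by half of the total makes them antiperiodic.
  set P := ∑ i ∈ Finset.range n, p i with hP
  set Q := ∑ i ∈ Finset.range n, q i with hQ
  set a : ℕ → ℝ := fun j => ∑ i ∈ Finset.range j, p i - P / 2 with ha
  set b : ℕ → ℝ := fun j => ∑ i ∈ Finset.range j, q i - Q / 2 with hb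
  have hpa : ∀ j, p j = a (j + 1) - a j := fun j => by simp [ha, Finset.sum_range_succ]
  have hqb : ∀ j, q j = b (j + 1) - b j := fun j => by simp [hb, Finset.sum_range_succ]
  have han : a n = -a 0 := by simp only [ha, ← hP, Finset.range_zero, Finset.sum_empty]; ring
  have hbn : b n = -b 0 := by simp only [hb, ← hQ, Finset.range_zero, Finset.sum_empty]; ring
  have hin : ∀ j, ∑ i ∈ Finset.range j, (p i * q j - q i * p j)
      = (a j + a (j + 1)) * (b (j + 1) - b j) - (a (j + 1) * b (j + 1) - a j * b j)
        + (P / 2 * q j - Q / 2 * p j) := fun j => by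
    rw [Finset.sum_sub_distrib, ← Finset.sum_mul, ← Finset.sum_mul,
      show ∑ i ∈ Finset.range j, p i = a j + P / 2 by simp [ha],
      show ∑ i ∈ Finset.range j, q i = b j + Q / 2 by simp [hb], hpa, hqb]
    ring
  have hsum : ∑ j ∈ Finset.range n, ∑ i ∈ Finset.range j, (p i * q j - q i * p j)
      = ∑ j ∈ Finset.range n, (a j + a (j + 1)) * (b (j + 1) - b j) := by
    rw [Finset.sum_congr rfl fun j _ => hin j, Finset.sum_add_distrib, Finset.sum_sub_distrib,
      Finset.sum_range_sub (fun j => a j * b j), Finset.sum_sub_distrib, ← Finset.mul_sum,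
      ← Finset.mul_sum, ← hP, ← hQ, han, hbn]
    ring
  have hW := sum_add_succ_sq_le hn a han
  rw [hsum, Real.cot_eq_cos_div_sin, Finset.sum_congr rfl fun j _ =>
    show p j ^ 2 + q j ^ 2 = (a (j + 1) - a j) ^ 2 + (b (j + 1) - b j) ^ 2 by rw [hpa, hqb]]
  set s := Real.sin (Real.pi / (2 * n))
  set c := Real.cos (Real.pi / (2 * n))
  have hterm : ∀ j ∈ Finset.range n, (a j + a (j + 1)) * (b (j + 1) - b j)
      ≤ 1 / (2 * c * s) * (s ^ 2 * (a j + a (j + 1)) ^ 2)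
        + c / (2 * s) * (b (j + 1) - b j) ^ 2 := fun j _ => by
    have : 0 ≤ (s * (a j + a (j + 1)) - c * (b (j + 1) - b j)) ^ 2 / (2 * c * s) := by
      positivity
    have e : (s * (a j + a (j + 1)) - c * (b (j + 1) - b j)) ^ 2 / (2 * c * s)
        = 1 / (2 * c * s) * (s ^ 2 * (a j + a (j + 1)) ^ 2)
        + c / (2 * s) * (b (j + 1) - b j) ^ 2 - (a j + a (j + 1)) * (b (j + 1) - b j) := by
      field_simp
      ring
    linarith
  refine (Finset.sum_le_sum hterm).trans ?_
  rw [Finset.sum_add_distrib, Finset.sum_add_distrib, ← Finset.mul_sum, ← Finset.mul_sum,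
    ← Finset.mul_sum]
  have h2 := mul_le_mul_of_nonneg_left hW (show 0 ≤ 1 / (2 * c * s) by positivity)
  refine (add_le_add_left h2 _).trans (le_of_eq ?_)
  field_simp

theorem sum_range_sum_range_eq_two_mul {f : ℕ → ℕ → ℝ} (hsymm : ∀ i j, f i j = f j i)
    (hdiag : ∀ i, f i i = 0) (n : ℕ) :
    ∑ i ∈ Finset.range n, ∑ j ∈ Finset.range n, f i j
      = 2 * ∑ j ∈ Finset.range n, ∑ i ∈ Finset.range j, f i j := by
  induction n with
  | zero => simp
  | succ n ih =>
    simp only [Finset.sum_range_succ, Finset.sum_add_distrib, ih, hdiag]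
    rw [Finset.sum_congr rfl fun j _ => hsymm n j]
    ring

theorem conj_mul_im_nonneg {z w : ℂ} (hz : 0 ≤ z.im) (hzw : z.arg ≤ w.arg) :
    0 ≤ ((starRingEnd ℂ) z * w).im := by
  have h0 := Complex.arg_nonneg_iff.2 hz
  have hpi := Complex.arg_le_pi w
  have hs := Real.sin_nonneg_of_nonneg_of_le_pi (sub_nonneg.2 hzw) (by linarith)
  rw [Real.sin_sub] at hs
  have := mul_nonneg (mul_nonneg (norm_nonneg z) (norm_nonneg w)) hs
  rw [Complex.mul_im, Complex.conj_re, Complex.conj_im]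
  rw [← Complex.norm_mul_cos_arg z, ← Complex.norm_mul_cos_arg w,
    ← Complex.norm_mul_sin_arg z, ← Complex.norm_mul_sin_arg w]
  linarith

/-- The sum of absolute cross products does not change under permutations and sign changes of the
vectors, so they may be taken in the upper half-plane and in the order of their arguments; then
all cross products with `i < j` are nonnegative and `sum_cross_le` applies. -/
theorem sum_abs_conj_mul_im_le {n : ℕ} (hn : 2 ≤ n) (v : Fin n → ℂ) :
    ∑ i, ∑ j, |((starRingEnd ℂ) (v i) * v j).im|
      ≤ Real.cot (Real.pi / (2 * n)) * ∑ i, ‖v i‖ ^ 2 := by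
  set u : Fin n → ℂ := fun i => if 0 ≤ (v i).im then v i else -v i with hu
  have huim : ∀ i, 0 ≤ (u i).im := fun i => by
    simp only [hu]; split_ifs with h
    · exact h
    · simp only [Complex.neg_im]; linarith
  have hnorm : ∀ i, ‖v i‖ = ‖u i‖ := fun i => by
    simp only [hu]; split_ifs <;> simp
  have habs : ∀ i j, |((starRingEnd ℂ) (v i) * v j).im|
      = |((starRingEnd ℂ) (u i) * u j).im| := fun i j => by
    simp only [hu]
    split_ifs <;> simp only [map_neg, neg_mul, mul_neg, neg_neg, Complex.neg_im, abs_neg]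
  set σ := Tuple.sort fun i => (u i).arg
  have hσ : Monotone ((fun i => (u i).arg) ∘ σ) := Tuple.monotone_sort _
  set x : ℕ → ℂ := fun k => if h : k < n then u (σ ⟨k, h⟩) else 0 with hx
  have hxk : ∀ i : Fin n, u (σ i) = x i := fun i => by simp [hx]
  have e1 : ∑ i, ∑ j, |((starRingEnd ℂ) (v i) * v j).im|
      = ∑ i ∈ Finset.range n, ∑ j ∈ Finset.range n, |((starRingEnd ℂ) (x i) * x j).im| := by
    simp only [habs, Finset.sum_range]
    rw [← Equiv.sum_comp σ]
    refine Finset.sum_congr rfl fun i _ => ?_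
    rw [← Equiv.sum_comp σ]
    simp only [hxk]
  have e2 : ∑ i, ‖v i‖ ^ 2 = ∑ i ∈ Finset.range n, ((x i).re ^ 2 + (x i).im ^ 2) := by
    simp only [hnorm, Finset.sum_range]
    rw [← Equiv.sum_comp σ]
    simp only [hxk, Complex.sq_norm, Complex.normSq_apply, ← sq]
  have hsymm : ∀ i j, |((starRingEnd ℂ) (x i) * x j).im|
      = |((starRingEnd ℂ) (x j) * x i).im| := fun i j => by
    rw [← abs_neg, ← Complex.conj_im, map_mul, Complex.conj_conj, mul_comm]
  rw [e1, e2, sum_range_sum_range_eq_two_mul hsymm fun i => by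
    simp [Complex.mul_im]; ring]
  have e3 : ∑ j ∈ Finset.range n, ∑ i ∈ Finset.range j, |((starRingEnd ℂ) (x i) * x j).im|
      = ∑ j ∈ Finset.range n, ∑ i ∈ Finset.range j,
        ((x i).re * (x j).im - (x i).im * (x j).re) := by
    refine Finset.sum_congr rfl fun j hj => Finset.sum_congr rfl fun i hi => ?_
    rw [Finset.mem_range] at hi hj
    rw [abs_of_nonneg]
    · simp only [Complex.mul_im, Complex.conj_re, Complex.conj_im]; ring
    · have hi' := hi.trans hj
      simp only [hx, hi', hj, dif_pos]
      exact conj_mul_im_nonneg (huim _) (hσ (show (⟨i, hi'⟩ : Fin n) ≤ ⟨j, hj⟩ from hi.le))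
  rw [e3]
  linarith [sum_cross_le hn (fun k => (x k).re) (fun k => (x k).im)]

/-! ### Cyclic products in a half-plane -/

/-- Tangent lines lie above the graph of the strictly concave function `log ∘ cos`. -/
theorem log_cos_lt_tangent {α η : ℝ} (hα : α ∈ Set.Ioo (-(Real.pi / 2)) (Real.pi / 2))
    (hη : η ∈ Set.Ioo (-(Real.pi / 2)) (Real.pi / 2)) (hne : η ≠ α) :
    Real.log (Real.cos η) < Real.log (Real.cos α) - Real.tan α * (η - α) := by
  have hd : ∀ x ∈ Set.Ioo (-(Real.pi / 2)) (Real.pi / 2),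
      HasDerivAt (fun x => Real.log (Real.cos x)) (-Real.tan x) x := fun x hx => by
    have := (Real.hasDerivAt_cos x).log (Real.cos_pos_of_mem_Ioo hx).ne'
    rwa [neg_div, ← Real.tan_eq_sin_div_cos] at this
  have hconc : StrictConcaveOn ℝ (Set.Ioo (-(Real.pi / 2)) (Real.pi / 2))
      (fun x => Real.log (Real.cos x)) := by
    apply StrictAntiOn.strictConcaveOn_of_deriv (convex_Ioo _ _)
    · exact fun x hx => (hd x hx).continuousAt.continuousWithinAt
    · rw [interior_Ioo]
      intro x hx y hy hxy
      rw [(hd x hx).deriv, (hd y hy).deriv]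
      exact neg_lt_neg (Real.strictMonoOn_tan hx hy hxy)
  rcases lt_or_gt_of_ne hne with h | h
  · have := hconc.lt_slope_of_hasDerivAt hη hα h (hd α hα)
    rw [slope_def_field, lt_div_iff₀ (by linarith)] at this
    linarith
  · have := hconc.slope_lt_of_hasDerivAt hα hη h (hd α hα)
    rw [slope_def_field, div_lt_iff₀ (by linarith)] at this
    linarith

/-- In the half-plane `cos α ≤ re u`, whose boundary passes through `exp (α I)`, the modulus is
bounded below by the logarithmic spiral through `exp (α I)` tangent to the boundary there. -/
theorem tan_mul_lt_log_norm {α : ℝ} (hα : α ∈ Set.Ioo (-(Real.pi / 2)) (Real.pi / 2)) {u : ℂ}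
    (hu : Real.cos α ≤ u.re) (hne : u ≠ Complex.exp (α * Complex.I)) :
    Real.tan α * (u.arg - α) < Real.log ‖u‖ := by
  have hcα := Real.cos_pos_of_mem_Ioo hα
  have hre : 0 < u.re := hcα.trans_le hu
  have hu0 : u ≠ 0 := by rintro rfl; simp at hre
  have hη : u.arg ∈ Set.Ioo (-(Real.pi / 2)) (Real.pi / 2) := by
    have := Complex.abs_arg_lt_pi_div_two_iff.2 (Or.inl hre)
    exact abs_lt.1 this
  have hcη := Real.cos_pos_of_mem_Ioo hη
  have hnorm : 0 < ‖u‖ := norm_pos_iff.2 hu0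
  rw [← Complex.norm_mul_cos_arg] at hu
  by_cases h : u.arg = α
  · rw [h] at hu ⊢
    have h1 : 1 ≤ ‖u‖ := by
      by_contra! hlt
      nlinarith
    have h1' : ‖u‖ ≠ 1 := fun h1' => hne (by
      rw [← h]; conv_lhs => rw [← Complex.norm_mul_exp_arg_mul_I u]
      simp [h1'])
    rw [sub_self, mul_zero]
    exact Real.log_pos (lt_of_le_of_ne h1 (Ne.symm h1'))
  · have h1 := log_cos_lt_tangent hα hη h
    have h2 := Real.log_le_log hcα hu
    rw [Real.log_mul hnorm.ne' hcη.ne'] at h2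
    linarith

/-- If numbers different from `1` in a half-plane that has `1` on its boundary and `0` outside have
product `1`, their arguments must wind around `0`, which takes at least `π / α` factors, where
`cos α` is the distance from `0` to the half-plane. -/
theorem pi_le_mul_of_prod_eq_one {m : ℕ} {α : ℝ} (hα0 : 0 < α) (hα : α < Real.pi / 2)
    (hm : 0 < m) (w : ℕ → ℂ) (hprod : ∏ k ∈ Finset.range m, w k = 1)
    (hw : ∀ k, Real.cos α ≤ (Complex.exp (α * Complex.I) * w k).re) (hne : ∀ k, w k ≠ 1) :
    Real.pi ≤ m * α := by
  have hmem : α ∈ Set.Ioo (-(Real.pi / 2)) (Real.pi / 2) := ⟨by linarith, hα⟩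
  have hcα := Real.cos_pos_of_mem_Ioo hmem
  have htan := Real.tan_pos_of_pos_of_lt_pi_div_two hα0 hα
  set u : ℕ → ℂ := fun k => Complex.exp (α * Complex.I) * w k with hu
  have hre : ∀ k, 0 < (u k).re := fun k => hcα.trans_le (hw k)
  have hu0 : ∀ k, u k ≠ 0 := fun k h => by have := hre k; simp [h] at this
  have huprod : ∏ k ∈ Finset.range m, u k = Complex.exp ((m * α : ℝ) * Complex.I) := by
    simp only [hu, Finset.prod_mul_distrib, hprod, Finset.prod_const, Finset.card_range,
      ← Complex.exp_nat_mul, mul_one]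
    push_cast; ring_nf
  have hnorm : ∏ k ∈ Finset.range m, ‖u k‖ = 1 := by
    rw [← norm_prod, huprod, Complex.norm_exp_ofReal_mul_I]
  have hlog : ∑ k ∈ Finset.range m, Real.log ‖u k‖ = 0 := by
    rw [← Real.log_prod fun k _ => norm_ne_zero_iff.2 (hu0 k), hnorm, Real.log_one]
  obtain ⟨N, hN⟩ : ∃ N : ℤ, m * α = (∑ k ∈ Finset.range m, (u k).arg) + N * (2 * Real.pi) := by
    have h : Complex.exp ((m * α : ℝ) * Complex.I)
        = Complex.exp ((∑ k ∈ Finset.range m, (u k).arg : ℝ) * Complex.I) := by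
      rw [← huprod]
      conv_lhs => rw [Finset.prod_congr rfl fun k _ => (Complex.norm_mul_exp_arg_mul_I (u k)).symm]
      rw [Finset.prod_mul_distrib, ← Complex.ofReal_prod, hnorm, Complex.ofReal_one, one_mul,
        ← Complex.exp_sum, Complex.ofReal_sum, Finset.sum_mul]
    obtain ⟨N, hN⟩ := Complex.exp_eq_exp_iff_exists_int.1 h
    refine ⟨N, ?_⟩
    have := congrArg Complex.im hN
    simpa using this
  have hm' : (Finset.range m).Nonempty := Finset.nonempty_range_iff.2 hm.ne'
  -- The tangent line at `α` excludes winding number `N ≤ 0`, the one at `-α` bounds `N π` by `m α`.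
  have hup := Finset.sum_lt_sum_of_nonempty hm' fun k _ =>
    tan_mul_lt_log_norm hmem (hw k) fun h => hne k (by
      have := mul_left_cancel₀ (Complex.exp_ne_zero _) (h.trans (mul_one _).symm)
      exact this)
  have hlow := Finset.sum_le_sum fun k (_ : k ∈ Finset.range m) =>
    show Real.tan (-α) * ((u k).arg - -α) ≤ Real.log ‖u k‖ by
      by_cases h : u k = Complex.exp ((-α : ℝ) * Complex.I)
      · rw [h, Complex.norm_exp_ofReal_mul_I, Complex.arg_exp_mul_I]
        rw [toIocMod_eq_self Real.two_pi_pos |>.2 ⟨by linarith, by linarith⟩]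
        simp
      · exact (tan_mul_lt_log_norm ⟨by linarith, by linarith⟩
          (by rw [Real.cos_neg]; exact hw k) h).le
  rw [← Finset.mul_sum, hlog, Finset.sum_sub_distrib, Finset.sum_const, Finset.card_range,
    nsmul_eq_mul] at hup hlow
  have h1 : ∑ k ∈ Finset.range m, (u k).arg < m * α := by
    by_contra! h
    nlinarith
  have h2 : -(m * α) ≤ ∑ k ∈ Finset.range m, (u k).arg := by
    by_contra! h
    rw [Real.tan_neg] at hlow
    nlinarith
  have hNpos : 0 < N := by
    by_contra! h
    have : (N : ℝ) ≤ 0 := by exact_mod_cast h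
    nlinarith [Real.pi_pos]
  have hN1 : (1 : ℝ) ≤ N := by exact_mod_cast hNpos
  nlinarith [Real.pi_pos]

/-! ### Eigenvalues of Laplacian matrices -/

/-- The eigenvalue equation writes `1` as the combination of the numbers `(1 - v j / v i) / z` with
weights `-L i j`, nonnegative for `j ≠ i`; not all of these numbers that are nonzero can lie
strictly below the real axis. -/
theorem exists_ratio_mem_halfPlane {n : ℕ} {L : Matrix (Fin n) (Fin n) ℝ}
    (hL : IsStandardizedLaplacian L) {v : Fin n → ℂ} {z : ℂ} (hz0 : z ≠ 0)
    (hv : ∀ i, ∑ j, (L i j : ℂ) * v j = z * v i) {i : Fin n} (hi : v i ≠ 0) :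
    ∃ j, v j / v i ≠ 1 ∧ 0 ≤ ((1 - v j / v i) / z).im := by
  have hsum : ∑ j, (-L i j : ℂ) * ((1 - v j / v i) / z) = 1 := by
    have h0 : ∑ j, (L i j : ℂ) = 0 := by exact_mod_cast hL.row_sum_eq_zero i
    have e : ∀ j, (-L i j : ℂ) * ((1 - v j / v i) / z)
        = (L i j * v j) / (v i * z) - L i j / z := fun j => by field_simp; ring
    rw [Finset.sum_congr rfl fun j _ => e j, Finset.sum_sub_distrib, ← Finset.sum_div,
      ← Finset.sum_div, h0, hv]
    field_simp
    ring
  by_contra! hcon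
  have him : ∑ j, -L i j * ((1 - v j / v i) / z).im = 0 := by
    have := congrArg Complex.im hsum
    rw [Complex.im_sum, Complex.one_im] at this
    rw [← this]
    refine Finset.sum_congr rfl fun j _ => ?_
    rw [← Complex.ofReal_neg, Complex.im_ofReal_mul]
  have hnonpos : ∀ j ∈ Finset.univ, -L i j * ((1 - v j / v i) / z).im ≤ 0 := fun j _ => by
    by_cases hj : v j / v i = 1
    · simp [hj]
    · have hij : i ≠ j := by rintro rfl; exact hj (div_self hi)
      exact mul_nonpos_of_nonneg_of_nonpos (neg_nonneg.2 (hL.off_diag_nonpos i j hij))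
        (hcon j hj).le
  have hzero := (Finset.sum_eq_zero_iff_of_nonpos hnonpos).1 him
  refine one_ne_zero (hsum.symm.trans (Finset.sum_eq_zero fun j hj => ?_))
  by_cases h : v j / v i = 1
  · simp [h]
  · rcases mul_eq_zero.1 (hzero j hj) with h0 | h0
    · rw [← Complex.ofReal_neg, h0, Complex.ofReal_zero, zero_mul]
    · exact absurd h0 (hcon j h).ne

/-- A relation in which every point of a nonempty subset of `Fin n` has a successor in the subset
has a closed walk of length at most `n`. -/
theorem exists_cycle {n : ℕ} {S : Fin n → Prop} {R : Fin n → Fin n → Prop}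
    (hS : ∃ i, S i) (hR : ∀ i, S i → ∃ j, S j ∧ R i j) :
    ∃ (m : ℕ) (x : ℕ → Fin n), 0 < m ∧ m ≤ n ∧ x m = x 0 ∧
      ∀ k, S (x k) ∧ R (x k) (x (k + 1)) := by
  obtain ⟨i₀, hi₀⟩ := hS
  choose! f hfS hfR using hR
  have hit : ∀ k, S (f^[k] i₀) := fun k => by
    induction k with
    | zero => exact hi₀
    | succ k ih => rw [Function.iterate_succ_apply']; exact hfS _ ih
  obtain ⟨a, b, hab, heq⟩ := Fintype.exists_ne_map_eq_of_card_lt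
    (fun k : Fin (n + 1) => f^[k] i₀) (by simp)
  wlog hlt : a < b generalizing a b
  · exact this b a hab.symm heq.symm (lt_of_le_of_ne (not_lt.1 hlt) hab.symm)
  refine ⟨b - a, fun k => f^[a + k] i₀, ?_, ?_, ?_, fun k => ⟨hit _, ?_⟩⟩
  · have : (a : ℕ) < b := hlt
    omega
  · omega
  · have : (a : ℕ) < b := hlt
    simp only [add_zero]
    rw [show (a : ℕ) + (b - a) = b by omega]
    exact heq.symm
  · simp only [← add_assoc, Function.iterate_succ_apply']
    exact hfR _ (hit _)

/-- Along a closed walk of admissible ratios `v j / v i` the product is `1`, and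
`pi_le_mul_of_prod_eq_one` bounds the length of the walk from below. -/
theorem arg_le_of_eigenvector {n : ℕ} {L : Matrix (Fin n) (Fin n) ℝ}
    (hL : IsStandardizedLaplacian L) {v : Fin n → ℂ} {z : ℂ} (hre : 0 < z.re) (him : 0 < z.im)
    (hv0 : v ≠ 0) (hv : ∀ i, ∑ j, (L i j : ℂ) * v j = z * v i) :
    z.arg ≤ Real.pi / 2 - Real.pi / n := by
  have hz0 : z ≠ 0 := by rintro rfl; simp at hre
  have hz : 0 < ‖z‖ := norm_pos_iff.2 hz0
  have hlt : z.arg < Real.pi / 2 :=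
    (abs_lt.1 (Complex.abs_arg_lt_pi_div_two_iff.2 (Or.inl hre))).2
  have hpos : 0 < z.arg := by
    refine lt_of_le_of_ne (Complex.arg_nonneg_iff.2 him.le) fun h => ?_
    rw [← Complex.norm_mul_sin_arg, ← h] at him
    simp at him
  set α := Real.pi / 2 - z.arg with hα
  have hE : Complex.exp (α * Complex.I) = Complex.I * ‖z‖ / z := by
    have h1 := Complex.norm_mul_exp_arg_mul_I z
    rw [eq_div_iff hz0]
    conv_lhs => rw [← h1]
    rw [mul_left_comm, ← Complex.exp_add, hα]
    push_cast
    rw [← add_mul, sub_add_cancel, Complex.exp_pi_div_two_mul_I]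
    ring
  -- The half-plane of admissible ratios lies at distance `cos α > 0` from `0`; in particular a
  -- ratio in it is nonzero, so `v` does not vanish along the walk.
  have hhalf : ∀ w : ℂ, 0 ≤ ((1 - w) / z).im →
      Real.cos α ≤ (Complex.exp (α * Complex.I) * w).re := fun w hw => by
    have e : Complex.exp (α * Complex.I) * w
        = Complex.exp (α * Complex.I) - (‖z‖ : ℂ) * (Complex.I * ((1 - w) / z)) := by
      rw [hE]; ring
    rw [e, Complex.sub_re, Complex.exp_ofReal_mul_I_re, Complex.re_ofReal_mul, Complex.I_mul_re]
    nlinarith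
  have hcα : 0 < Real.cos α := Real.cos_pos_of_mem_Ioo ⟨by linarith, by linarith⟩
  obtain ⟨m, x, hm, hmn, hxm, hx⟩ := exists_cycle (S := fun i => v i ≠ 0)
    (R := fun i j => v j / v i ≠ 1 ∧ 0 ≤ ((1 - v j / v i) / z).im)
    (Function.ne_iff.1 hv0) fun i hi => by
      obtain ⟨j, h1, h2⟩ := exists_ratio_mem_halfPlane hL hz0 hv hi
      refine ⟨j, fun hj => ?_, h1, h2⟩
      have := hhalf _ h2
      rw [hj, zero_div, mul_zero, Complex.zero_re] at this
      linarith
  have hprod : ∏ k ∈ Finset.range m, v (x (k + 1)) / v (x k) = 1 := by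
    have htel : ∀ l, ∏ k ∈ Finset.range l, v (x (k + 1)) / v (x k) = v (x l) / v (x 0) :=
      fun l => by
        induction l with
        | zero => simp [div_self (hx 0).1]
        | succ l ih =>
          rw [Finset.prod_range_succ, ih, mul_comm, div_mul_div_cancel₀ (hx l).1]
    rw [htel, hxm, div_self (hx 0).1]
  have hmα := pi_le_mul_of_prod_eq_one (by linarith) (by linarith) hm
    (fun k => v (x (k + 1)) / v (x k)) hprod (fun k => hhalf _ (hx k).2.2) fun k => (hx k).2.1
  have hn0 : (0 : ℝ) < n := by exact_mod_cast hm.trans_le hmn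
  have hmn' : (m : ℝ) ≤ n := by exact_mod_cast hmn
  have : Real.pi / n ≤ α := by
    rw [div_le_iff₀ hn0]
    nlinarith
  linarith

theorem exists_eigenvector {n : ℕ} {L : Matrix (Fin n) (Fin n) ℝ} {z : ℂ}
    (hz : Module.End.HasEigenvalue (Matrix.toLin' (L.map (fun x : ℝ => (x : ℂ)))) z) :
    ∃ v : Fin n → ℂ, v ≠ 0 ∧ ∀ i, ∑ j, (L i j : ℂ) * v j = z * v i := by
  obtain ⟨v, hv⟩ := hz.exists_hasEigenvector
  refine ⟨v, hv.2, fun i => ?_⟩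
  have := congrFun hv.apply_eq_smul i
  simpa [Matrix.toLin'_apply, Matrix.mulVec, dotProduct] using this

/-- Gershgorin's theorem: the disk of a row of a Laplacian matrix passes through `0`. -/
theorem exists_mem_closedBall_diag {n : ℕ} {L : Matrix (Fin n) (Fin n) ℝ}
    (hL : IsStandardizedLaplacian L) {z : ℂ}
    (hz : Module.End.HasEigenvalue (Matrix.toLin' (L.map (fun x : ℝ => (x : ℂ)))) z) :
    ∃ d : ℝ, 0 ≤ d ∧ d ≤ 1 - 1 / n ∧ z ∈ Metric.closedBall (d : ℂ) d := by
  obtain ⟨k, hk⟩ := eigenvalue_mem_ball hz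
  have hdiag : ∑ j ∈ Finset.univ.erase k, -L k j = L k k := by
    have := hL.row_sum_eq_zero k
    rw [← Finset.add_sum_erase _ _ (Finset.mem_univ k)] at this
    rw [Finset.sum_neg_distrib]
    linarith
  have hnonneg : ∀ j ∈ Finset.univ.erase k, 0 ≤ -L k j := fun j hj =>
    neg_nonneg.2 (hL.off_diag_nonpos k j (Finset.ne_of_mem_erase hj).symm)
  refine ⟨L k k, hdiag ▸ Finset.sum_nonneg hnonneg, ?_, ?_⟩
  · rw [← hdiag]
    have hn : (n : ℝ) ≠ 0 := by exact_mod_cast (Fin.pos k).ne'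
    refine (Finset.sum_le_card_nsmul _ _ (1 / (n : ℝ)) fun j hj =>
      (neg_le_abs _).trans (hL.abs_off_diag_le k j (Finset.ne_of_mem_erase hj).symm)).trans
        (le_of_eq ?_)
    rw [Finset.card_erase_of_mem (Finset.mem_univ k), Finset.card_univ, Fintype.card_fin,
      nsmul_eq_mul, Nat.cast_sub (Fin.pos k)]
    field_simp
    simp
  · have e : ∑ j ∈ Finset.univ.erase k, ‖(L.map (fun x : ℝ => (x : ℂ))) k j‖ = L k k := by
      rw [← hdiag]
      refine Finset.sum_congr rfl fun j hj => ?_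
      rw [Matrix.map_apply, Complex.norm_real, Real.norm_eq_abs, ← abs_neg,
        abs_of_nonneg (hnonneg j hj)]
    rw [e] at hk
    exact hk

theorem norm_sub_le_of_hasEigenvalue {n : ℕ} {L : Matrix (Fin n) (Fin n) ℝ}
    (hL : IsStandardizedLaplacian L) {z : ℂ}
    (hz : Module.End.HasEigenvalue (Matrix.toLin' (L.map (fun x : ℝ => (x : ℂ)))) z) :
    ‖z - (1 - 1 / (n : ℂ))‖ ≤ 1 - 1 / (n : ℝ) := by
  obtain ⟨d, hd0, hd, hzd⟩ := exists_mem_closedBall_diag hL hz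
  rw [Metric.mem_closedBall, dist_eq_norm] at hzd
  have e : z - (1 - 1 / (n : ℂ)) = (z - d) - ((1 - 1 / (n : ℝ) - d : ℝ) : ℂ) := by
    push_cast; ring
  rw [e]
  refine (norm_sub_le _ _).trans ?_
  rw [Complex.norm_real, Real.norm_eq_abs, abs_of_nonneg (by linarith)]
  linarith

theorem re_pos_of_hasEigenvalue {n : ℕ} {L : Matrix (Fin n) (Fin n) ℝ}
    (hL : IsStandardizedLaplacian L) {z : ℂ} (hz0 : z ≠ 0)
    (hz : Module.End.HasEigenvalue (Matrix.toLin' (L.map (fun x : ℝ => (x : ℂ)))) z) :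
    0 < z.re := by
  obtain ⟨d, hd0, -, hzd⟩ := exists_mem_closedBall_diag hL hz
  rw [Metric.mem_closedBall, dist_eq_norm] at hzd
  have h1 : ‖z - d‖ ^ 2 ≤ d ^ 2 := by gcongr
  rw [Complex.sq_norm, Complex.normSq_apply] at h1
  simp only [Complex.sub_re, Complex.ofReal_re, Complex.sub_im, Complex.ofReal_im,
    sub_zero] at h1
  have h2 : 0 < Complex.normSq z := Complex.normSq_pos.2 hz0
  rw [Complex.normSq_apply] at h2
  by_contra! h
  nlinarith

theorem abs_im_mul_sin_le {n : ℕ} (hn : 2 ≤ n) {L : Matrix (Fin n) (Fin n) ℝ}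
    (hL : IsStandardizedLaplacian L) {z : ℂ}
    (hz : Module.End.HasEigenvalue (Matrix.toLin' (L.map (fun x : ℝ => (x : ℂ)))) z) :
    |z.im| * Real.sin (Real.pi / n) ≤ z.re * Real.cos (Real.pi / n) := by
  have hn2 : (2 : ℝ) ≤ n := by exact_mod_cast hn
  have hθ0 : 0 < Real.pi / n := by positivity
  have hθ : Real.pi / n ≤ Real.pi / 2 := by gcongr
  have hcos : 0 ≤ Real.cos (Real.pi / n) :=
    Real.cos_nonneg_of_mem_Icc ⟨by linarith [Real.pi_pos], hθ⟩
  rcases eq_or_ne z 0 with rfl | hz0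
  · simp
  have hre := re_pos_of_hasEigenvalue hL hz0 hz
  -- Conjugation fixes `L`, so the lower half-plane reduces to the upper one.
  have key : ∀ (v : Fin n → ℂ) (y : ℂ), 0 < y.re → 0 < y.im → v ≠ 0 →
      (∀ i, ∑ j, (L i j : ℂ) * v j = y * v i) →
      y.im * Real.sin (Real.pi / n) ≤ y.re * Real.cos (Real.pi / n) :=
    fun v y hre him hv0 hv => by
      have h := arg_le_of_eigenvector hL hre him hv0 hv
      have h0 := Complex.arg_nonneg_iff.2 him.le
      have hc := Real.cos_nonneg_of_mem_Icc (x := y.arg + Real.pi / n)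
        ⟨by linarith [Real.pi_pos], by linarith⟩
      have := mul_nonneg (norm_nonneg y) hc
      rw [Real.cos_add] at this
      rw [← Complex.norm_mul_cos_arg y, ← Complex.norm_mul_sin_arg y]
      linarith
  obtain ⟨v, hv0, hv⟩ := exists_eigenvector hz
  rcases lt_trichotomy z.im 0 with him | him | him
  · rw [abs_of_neg him]
    refine key (star v) ((starRingEnd ℂ) z) (by simpa using hre) (by simpa using him)
      (star_ne_zero.2 hv0) fun i => ?_
    have := congrArg (starRingEnd ℂ) (hv i)
    simpa using this
  · rw [him, abs_zero, zero_mul]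
    positivity
  · rw [abs_of_pos him]
    exact key v z hre him hv0 hv

/-- The bound of Pick: twice the imaginary part of the form `v* L v` is the sum of
`(L i j - L j i) Im (conj (v i) v j)`, and for `i ≠ j` both `L i j` and `L j i` lie in `[-1 / n, 0]`, so their difference is at most `1 / n`. -/
theorem abs_im_le_cot {n : ℕ} (hn : 2 ≤ n) {L : Matrix (Fin n) (Fin n) ℝ}
    (hL : IsStandardizedLaplacian L) {z : ℂ}
    (hz : Module.End.HasEigenvalue (Matrix.toLin' (L.map (fun x : ℝ => (x : ℂ)))) z) :
    |z.im| ≤ 1 / (2 * n) * Real.cot (Real.pi / (2 * n)) := by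
  have hn0 : (0 : ℝ) < n := by positivity
  obtain ⟨v, hv0, hv⟩ := exists_eigenvector hz
  set B : Fin n → Fin n → ℝ := fun i j => ((starRingEnd ℂ) (v i) * v j).im with hB
  have hBanti : ∀ i j, B j i = -B i j := fun i j => by
    simp only [hB]
    rw [← Complex.conj_im, map_mul, Complex.conj_conj, mul_comm]
  have h1 : z.im * ∑ i, ‖v i‖ ^ 2 = ∑ i, ∑ j, L i j * B i j := by
    rw [Finset.mul_sum]
    refine Finset.sum_congr rfl fun i _ => ?_
    have e : (starRingEnd ℂ) (v i) * (z * v i) = z * ((‖v i‖ ^ 2 : ℝ) : ℂ) := by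
      push_cast
      rw [← Complex.conj_mul']
      ring
    have := congrArg Complex.im e
    rw [Complex.im_mul_ofReal] at this
    rw [← this, ← hv, Finset.mul_sum, Complex.im_sum]
    refine Finset.sum_congr rfl fun j _ => ?_
    rw [mul_left_comm, Complex.im_ofReal_mul]
  have h2 : 2 * (z.im * ∑ i, ‖v i‖ ^ 2) = ∑ i, ∑ j, (L i j - L j i) * B i j := by
    have hswap : ∑ i, ∑ j, L j i * B i j = -∑ i, ∑ j, L i j * B i j := by
      rw [Finset.sum_comm, ← Finset.sum_neg_distrib]
      refine Finset.sum_congr rfl fun i _ => ?_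
      rw [← Finset.sum_neg_distrib]
      refine Finset.sum_congr rfl fun j _ => ?_
      rw [hBanti i j, mul_neg]
    simp only [sub_mul, Finset.sum_sub_distrib]
    rw [hswap, h1]
    ring
  have h3 : 2 * (|z.im| * ∑ i, ‖v i‖ ^ 2) ≤ 1 / n * ∑ i, ∑ j, |B i j| := by
    have hN : 0 ≤ ∑ i, ‖v i‖ ^ 2 := Finset.sum_nonneg fun i _ => by positivity
    have e : 2 * (|z.im| * ∑ i, ‖v i‖ ^ 2) = |2 * (z.im * ∑ i, ‖v i‖ ^ 2)| := by
      rw [abs_mul, abs_mul, abs_of_nonneg hN, abs_two]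
    rw [e, h2, Finset.mul_sum]
    refine (Finset.abs_sum_le_sum_abs _ _).trans (Finset.sum_le_sum fun i _ => ?_)
    rw [Finset.mul_sum]
    refine (Finset.abs_sum_le_sum_abs _ _).trans (Finset.sum_le_sum fun j _ => ?_)
    rw [abs_mul]
    gcongr
    rcases eq_or_ne i j with rfl | hij
    · rw [sub_self, abs_zero]; positivity
    · have a1 := hL.off_diag_nonpos i j hij
      have a2 := hL.off_diag_nonpos j i hij.symm
      have a3 := abs_le.1 (hL.abs_off_diag_le i j hij)
      have a4 := abs_le.1 (hL.abs_off_diag_le j i hij.symm)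
      rw [abs_le]
      constructor <;> linarith
  have h4 := sum_abs_conj_mul_im_le hn v
  have hpos : 0 < ∑ i, ‖v i‖ ^ 2 := by
    obtain ⟨i, hi⟩ := Function.ne_iff.1 hv0
    exact Finset.sum_pos' (fun j _ => by positivity)
      ⟨i, Finset.mem_univ i, pow_pos (norm_pos_iff.2 hi) 2⟩
  have h5 := h3.trans (mul_le_mul_of_nonneg_left h4 (by positivity))
  refine le_of_mul_le_mul_right ?_ hpos
  refine le_of_mul_le_mul_left (h5.trans (le_of_eq ?_)) two_pos
  field_simp

/-! ### The complementary Laplacian matrix -/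

/-- The Laplacian matrix complementary to `L`: it is `1 - J / n - L`, where all entries of `J` are
`1`, so that the off-diagonal entries of `L` and of its complement add up to `-1 / n`. -/
noncomputable def complementLaplacian {n : ℕ} (L : Matrix (Fin n) (Fin n) ℝ) :
    Matrix (Fin n) (Fin n) ℝ :=
  fun i j => (if i = j then 1 else 0) - 1 / (n : ℝ) - L i j

theorem isStandardizedLaplacian_complementLaplacian {n : ℕ} {L : Matrix (Fin n) (Fin n) ℝ}
    (hL : IsStandardizedLaplacian L) : IsStandardizedLaplacian (complementLaplacian L) where
  row_sum_eq_zero i := by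
    have hn : (n : ℝ) ≠ 0 := by exact_mod_cast (Fin.pos i).ne'
    simp [complementLaplacian, Finset.sum_sub_distrib, hL.row_sum_eq_zero, hn]
  off_diag_nonpos i j hij := by
    have := abs_le.1 (hL.abs_off_diag_le i j hij)
    simp only [complementLaplacian, if_neg hij]
    linarith
  abs_off_diag_le i j hij := by
    have h1 := abs_le.1 (hL.abs_off_diag_le i j hij)
    have h2 := hL.off_diag_nonpos i j hij
    simp only [complementLaplacian, if_neg hij]
    rw [abs_le]
    constructor <;> linarith

theorem hasEigenvalue_complementLaplacian {n : ℕ} {L : Matrix (Fin n) (Fin n) ℝ}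
    (hL : IsStandardizedLaplacian L) {z : ℂ} (hz0 : z ≠ 0) (hz1 : z ≠ 1)
    (hz : Module.End.HasEigenvalue (Matrix.toLin' (L.map (fun x : ℝ => (x : ℂ)))) z) :
    Module.End.HasEigenvalue
      (Matrix.toLin' ((complementLaplacian L).map (fun x : ℝ => (x : ℂ)))) (1 - z) := by
  obtain ⟨v, hv0, hv⟩ := exists_eigenvector hz
  have hrow : ∀ i, ∑ j, (L i j : ℂ) = 0 := fun i => by exact_mod_cast hL.row_sum_eq_zero i
  have hz1' : 1 - z ≠ 0 := sub_ne_zero.2 hz1.symm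
  -- Constants lie in the kernel of both matrices; subtracting `c` compensates the mean of `v`.
  set c : ℂ := (1 / n * ∑ j, v j) / (1 - z) with hc
  refine Module.End.hasEigenvalue_of_hasEigenvector (x := fun i => v i - c)
    ⟨Module.End.mem_eigenspace_iff.2 (funext fun i => ?_), fun h => hv0 (funext fun i => ?_)⟩
  · have hn : (n : ℂ) ≠ 0 := by exact_mod_cast (Fin.pos i).ne'
    have hcz : (1 - z) * c = 1 / n * ∑ j, v j := by rw [hc]; field_simp
    have hK : ∀ j, ((complementLaplacian L i j : ℝ) : ℂ) * (v j - c)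
        = (if i = j then v j else 0) - (if i = j then c else 0) - 1 / n * v j + 1 / n * c
          - L i j * v j + L i j * c := fun j => by
      simp only [complementLaplacian]
      split_ifs <;> push_cast <;> ring
    simp only [Matrix.toLin'_apply, Matrix.mulVec, dotProduct, Matrix.map_apply, Pi.smul_apply,
      smul_eq_mul, hK, Finset.sum_add_distrib, Finset.sum_sub_distrib, ← Finset.mul_sum,
      ← Finset.sum_mul, hrow, hv, Finset.sum_const, Finset.card_univ, Fintype.card_fin,
      Finset.sum_ite_eq, Finset.mem_univ, if_true, nsmul_eq_mul]
    rw [mul_sub, hcz]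
    field_simp
    ring
  · have hconst : ∀ j, v j = c := fun j => sub_eq_zero.1 (congrFun h j)
    have := hv i
    simp only [hconst, ← Finset.sum_mul, hrow, zero_mul] at this
    rw [hconst]
    exact (mul_eq_zero.1 this.symm).resolve_left hz0

theorem one_sub_eq_zero_or_one_or_hasEigenvalue {n : ℕ} {L : Matrix (Fin n) (Fin n) ℝ}
    (hL : IsStandardizedLaplacian L) {z : ℂ}
    (hz : Module.End.HasEigenvalue (Matrix.toLin' (L.map (fun x : ℝ => (x : ℂ)))) z) :
    1 - z = 0 ∨ 1 - z = 1 ∨ Module.End.HasEigenvalue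
      (Matrix.toLin' ((complementLaplacian L).map (fun x : ℝ => (x : ℂ)))) (1 - z) := by
  by_cases h1 : z = 1
  · exact Or.inl (by simp [h1])
  by_cases h0 : z = 0
  · exact Or.inr (Or.inl (by simp [h0]))
  exact Or.inr (Or.inr (hasEigenvalue_complementLaplacian hL h0 h1 hz))

/-! ### Membership in the angles -/

theorem exp_half_pi_sub_mul_I (n : ℕ) :
    Complex.exp (((Real.pi : ℂ) / 2 - (Real.pi : ℂ) / (n : ℂ)) * Complex.I)
      = Real.sin (Real.pi / n) + Real.cos (Real.pi / n) * Complex.I := by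
  rw [Complex.exp_mul_I, Complex.cos_pi_div_two_sub, Complex.sin_pi_div_two_sub]
  push_cast
  rfl

theorem exp_neg_half_pi_sub_mul_I (n : ℕ) :
    Complex.exp (-(((Real.pi : ℂ) / 2 - (Real.pi : ℂ) / (n : ℂ)) * Complex.I))
      = Real.sin (Real.pi / n) - Real.cos (Real.pi / n) * Complex.I := by
  rw [← neg_mul, Complex.exp_mul_I, Complex.cos_neg, Complex.sin_neg,
    Complex.cos_pi_div_two_sub, Complex.sin_pi_div_two_sub]
  push_cast
  ring

theorem exp_two_pi_mul_I_div_sub_one (n : ℕ) :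
    Complex.exp (2 * (Real.pi : ℂ) * Complex.I / (n : ℂ)) - 1
      = -(2 * Real.sin (Real.pi / n))
        * (Real.sin (Real.pi / n) - Real.cos (Real.pi / n) * Complex.I) := by
  rw [show 2 * (Real.pi : ℂ) * Complex.I / (n : ℂ) = 2 * (Real.pi / n) * Complex.I by ring,
    Complex.exp_mul_I, Complex.cos_two_mul', Complex.sin_two_mul]
  push_cast
  linear_combination Complex.sin_sq_add_cos_sq ((Real.pi : ℂ) / n)

theorem exp_neg_two_pi_mul_I_div_sub_one (n : ℕ) :
    Complex.exp (-(2 * (Real.pi : ℂ) * Complex.I / (n : ℂ))) - 1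
      = -(2 * Real.sin (Real.pi / n))
        * (Real.sin (Real.pi / n) + Real.cos (Real.pi / n) * Complex.I) := by
  rw [show -(2 * (Real.pi : ℂ) * Complex.I / (n : ℂ)) = -(2 * (Real.pi / n)) * Complex.I by ring,
    Complex.exp_mul_I, Complex.cos_neg, Complex.sin_neg, Complex.cos_two_mul',
    Complex.sin_two_mul]
  push_cast
  linear_combination Complex.sin_sq_add_cos_sq ((Real.pi : ℂ) / n)

theorem sin_pi_div_pos {n : ℕ} (hn : 2 ≤ n) : 0 < Real.sin (Real.pi / n) := by
  have hn2 : (2 : ℝ) ≤ n := by exact_mod_cast hn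
  refine Real.sin_pos_of_pos_of_lt_pi (by positivity) ?_
  rw [div_lt_iff₀ (by positivity)]
  nlinarith [Real.pi_pos]

theorem cos_pi_div_nonneg {n : ℕ} (hn : 2 ≤ n) : 0 ≤ Real.cos (Real.pi / n) := by
  have hn2 : (2 : ℝ) ≤ n := by exact_mod_cast hn
  have h0 : 0 < Real.pi / n := by positivity
  have h1 : Real.pi / n ≤ Real.pi / 2 := by gcongr
  exact Real.cos_nonneg_of_mem_Icc ⟨by linarith [Real.pi_pos], h1⟩

theorem exists_nonneg_combination {a b : ℝ} (ha : 0 < a) (hb : 0 ≤ b) {z : ℂ} (hre : 0 ≤ z.re)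
    (h : |z.im| * a ≤ z.re * b) :
    ∃ s t : ℝ, 0 ≤ s ∧ 0 ≤ t ∧
      z = s * (a - b * Complex.I) + t * (a + b * Complex.I) := by
  rcases hb.eq_or_lt with rfl | hb
  · have him : z.im = 0 := by
      rw [mul_zero] at h
      exact abs_eq_zero.1 (le_antisymm (nonpos_of_mul_nonpos_left h ha) (abs_nonneg _))
    refine ⟨z.re / a, 0, by positivity, le_rfl, Complex.ext ?_ ?_⟩
    · simp [ha.ne']
    · simp [him]
  · have h1 : |z.im| / b ≤ z.re / a := by rwa [div_le_div_iff₀ hb ha]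
    have h2 : z.im / b ≤ |z.im| / b := by gcongr; exact le_abs_self _
    have h3 : -z.im / b ≤ |z.im| / b := by gcongr; exact neg_le_abs _
    rw [neg_div] at h3
    refine ⟨(z.re / a - z.im / b) / 2, (z.re / a + z.im / b) / 2, by linarith, by linarith,
      Complex.ext ?_ ?_⟩
    · simp
      field_simp
      ring
    · simp
      field_simp
      ring

theorem mem_closedSmallerAngle_zero {n : ℕ} (hn : 2 ≤ n) {z : ℂ} (hre : 0 ≤ z.re)
    (h : |z.im| * Real.sin (Real.pi / n) ≤ z.re * Real.cos (Real.pi / n)) :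
    z ∈ closedSmallerAngle 0
      (Complex.exp (-(((Real.pi : ℂ) / 2 - (Real.pi : ℂ) / (n : ℂ)) * Complex.I)))
      (Complex.exp (((Real.pi : ℂ) / 2 - (Real.pi : ℂ) / (n : ℂ)) * Complex.I)) := by
  obtain ⟨s, t, hs, ht, e⟩ :=
    exists_nonneg_combination (sin_pi_div_pos hn) (cos_pi_div_nonneg hn) hre h
  refine ⟨s, t, hs, ht, ?_⟩
  rw [exp_half_pi_sub_mul_I, exp_neg_half_pi_sub_mul_I, sub_zero, sub_zero, zero_add]
  exact e

theorem mem_closedSmallerAngle_one {n : ℕ} (hn : 2 ≤ n) {z : ℂ} (hre : 0 ≤ (1 - z).re)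
    (h : |(1 - z).im| * Real.sin (Real.pi / n) ≤ (1 - z).re * Real.cos (Real.pi / n)) :
    z ∈ closedSmallerAngle 1
      (Complex.exp (-(2 * (Real.pi : ℂ) * Complex.I / (n : ℂ))))
      (Complex.exp (2 * (Real.pi : ℂ) * Complex.I / (n : ℂ))) := by
  have hsin := sin_pi_div_pos hn
  obtain ⟨s, t, hs, ht, e⟩ :=
    exists_nonneg_combination hsin (cos_pi_div_nonneg hn) hre h
  -- The sides at `1` are the sides at `0` reversed, interchanged and scaled by `2 sin (π / n)`.
  refine ⟨t / (2 * Real.sin (Real.pi / n)), s / (2 * Real.sin (Real.pi / n)), by positivity,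
    by positivity, ?_⟩
  rw [exp_two_pi_mul_I_div_sub_one, exp_neg_two_pi_mul_I_div_sub_one]
  have hsin' : (Real.sin (Real.pi / n) : ℂ) ≠ 0 := by exact_mod_cast hsin.ne'
  rw [Complex.ofReal_div, Complex.ofReal_div, Complex.ofReal_mul, Complex.ofReal_ofNat]
  generalize (Real.sin (Real.pi / n) : ℂ) = a at *
  generalize (Real.cos (Real.pi / n) : ℂ) = b at *
  field_simp
  linear_combination -e

/-! ### The spectral region -/

theorem re_nonneg_and_abs_im_mul_sin_le_of_one_sub {n : ℕ} (hn : 2 ≤ n)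
    {L : Matrix (Fin n) (Fin n) ℝ} (hL : IsStandardizedLaplacian L) {z : ℂ}
    (hz : Module.End.HasEigenvalue (Matrix.toLin' (L.map (fun x : ℝ => (x : ℂ)))) z) :
    0 ≤ (1 - z).re ∧
      |(1 - z).im| * Real.sin (Real.pi / n) ≤ (1 - z).re * Real.cos (Real.pi / n) := by
  have hc := cos_pi_div_nonneg hn
  rcases one_sub_eq_zero_or_one_or_hasEigenvalue hL hz with h | h | h
  · simp [h]
  · simp [h, hc]
  · have hK := isStandardizedLaplacian_complementLaplacian hL
    refine ⟨?_, abs_im_mul_sin_le hn hK h⟩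
    rcases eq_or_ne (1 - z) 0 with h0 | h0
    · simp [h0]
    · exact (re_pos_of_hasEigenvalue hK h0 h).le

theorem norm_sub_inv_le_of_hasEigenvalue {n : ℕ} (hn : 2 ≤ n)
    {L : Matrix (Fin n) (Fin n) ℝ} (hL : IsStandardizedLaplacian L) {z : ℂ}
    (hz : Module.End.HasEigenvalue (Matrix.toLin' (L.map (fun x : ℝ => (x : ℂ)))) z) :
    ‖z - 1 / (n : ℂ)‖ ≤ 1 - 1 / (n : ℝ) := by
  have hn2 : (2 : ℝ) ≤ n := by exact_mod_cast hn
  have hinv : 1 / (n : ℝ) ≤ 1 / 2 := by gcongr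
  have e : ‖z - 1 / (n : ℂ)‖ = ‖(1 - z) - (1 - 1 / (n : ℂ))‖ := by
    rw [← norm_neg]; congr 1; ring
  rw [e]
  rcases one_sub_eq_zero_or_one_or_hasEigenvalue hL hz with h | h | h
  · have e0 : (0 : ℂ) - (1 - 1 / (n : ℂ)) = -((1 - 1 / (n : ℝ) : ℝ) : ℂ) := by push_cast; ring
    rw [h, e0, norm_neg, Complex.norm_real, Real.norm_eq_abs, abs_of_nonneg (by linarith)]
  · have e1 : (1 : ℂ) - (1 - 1 / (n : ℂ)) = ((1 / (n : ℝ) : ℝ) : ℂ) := by push_cast; ring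
    rw [h, e1, Complex.norm_real, Real.norm_eq_abs, abs_of_nonneg (by positivity)]
    linarith
  · exact norm_sub_le_of_hasEigenvalue (isStandardizedLaplacian_complementLaplacian hL) h

theorem theorem8 (n : ℕ) (hn : 2 ≤ n) (L : Matrix (Fin n) (Fin n) ℝ)
    (hL : IsStandardizedLaplacian L) (z : ℂ)
    (hz : Module.End.HasEigenvalue (Matrix.toLin' (L.map (fun x : ℝ => (x : ℂ)))) z) :
    z ∈ (Metric.closedBall (1 / (n : ℂ)) (1 - 1 / (n : ℝ))
          ∩ Metric.closedBall (1 - 1 / (n : ℂ)) (1 - 1 / (n : ℝ)))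
        ∩ (closedSmallerAngle 1
              (Complex.exp (-(2 * (Real.pi : ℂ) * Complex.I / (n : ℂ))))
              (Complex.exp (2 * (Real.pi : ℂ) * Complex.I / (n : ℂ)))
          ∩ closedSmallerAngle 0
              (Complex.exp (-(((Real.pi : ℂ) / 2 - (Real.pi : ℂ) / (n : ℂ)) * Complex.I)))
              (Complex.exp (((Real.pi : ℂ) / 2 - (Real.pi : ℂ) / (n : ℂ)) * Complex.I)))
        ∩ {w : ℂ | |w.im| ≤ 1 / (2 * (n : ℝ)) * Real.cot (Real.pi / (2 * (n : ℝ)))} := by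
  have him := abs_im_mul_sin_le hn hL hz
  have hre : 0 ≤ z.re := by
    rcases eq_or_ne z 0 with rfl | h0
    · simp
    · exact (re_pos_of_hasEigenvalue hL h0 hz).le
  obtain ⟨hre', him'⟩ := re_nonneg_and_abs_im_mul_sin_le_of_one_sub hn hL hz
  refine ⟨⟨⟨?_, ?_⟩, mem_closedSmallerAngle_one hn hre' him',
    mem_closedSmallerAngle_zero hn hre him⟩, abs_im_le_cot hn hL hz⟩
  · rw [Metric.mem_closedBall, dist_eq_norm]
    exact norm_sub_inv_le_of_hasEigenvalue hn hL hz
  · rw [Metric.mem_closedBall, dist_eq_norm]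
    exact norm_sub_le_of_hasEigenvalue hL hz
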